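/- Let $G_A$ be an undirected simple graph on vertices $v_1,\dots,v_n$ ($n\ge 1$) with adjacency matrix $A$, let $t\in[0,1)$, and let $Y=\operatorname{diag}(1,\dots,1,t)$ be the $n\times n$ coloring matrix. Let $\beta(w)=\frac{1+iw}{1-iw}$, so $\beta^{-1}(z)=i\,\frac{1-z}{1+z}$; put $$f_A^t(w_1,w_2)=\Big(\big(A-w_1Y-w_2(I-Y)\big)^{-1}\Big)_{11},\qquad \phi_A^t(z_1,z_2)=\beta\big(f_A^t(\beta^{-1}(z_1),\beta^{-1}(z_2))\big)\quad (z_1, z_2\in\mathbb D),$$ and write $\phi_A^t=q_A^t/p_A^t$ with polynomials $q_A^t,p_A^t\in\mathbb C[z_1,z_2]$ that have no common factor. Write $p_A=p_A^0$. For a polynomial $p$ of bidegree $(m,k)$ let $\tilde p(z_1,z_2)=z_1^m z_2^k\,\overline{p(1/\bar z_1,1/\bar z_2)}$. The contact order of a stable polynomial $p$ at a zero $(\tau_1,\tau_2)\in\mathbb T^2$ is the number $K\in\mathbb N$ such that $$\inf\{1-|z_2| : \tilde p(z_1,z_2)=0\}\approx|\tau_1-z_1|^K$$ (bounded above and below by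 positive constant multiples) for $z_1\in\mathbb T\setminus\{\tau_1\}$ and $z_2\in\mathbb D$ sufficiently close to $\tau_1$ and $\tau_2$ respectively. Let $\tau_1,\tau_2\in\mathbb T\setminus\{-1\}$ and set $$\lambda_1=\tau_1,\qquad \lambda_2=\beta\left(\frac{\beta^{-1}(\tau_2)-t\,\beta^{-1}(\tau_1)}{1-t}\right).$$ Then $p_A(\tau_1,\tau_2)=0$ if and only if $p_A^t(\lambda_1,\lambda_2)=0$. In this case, the contact order of $p_A$ at $(\tau_1,\tau_2)$ and the contact order of $p_A^t$ at $(\lambda_1,\lambda_2)$ both exist and are uniquely determined, and they are equal. -/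

import Mathlib

open Filter Topology Asymptotics

noncomputable section

namespace GraphStable

/-- The conformal map `β : ℍ → 𝔻`, `β(w) = (1 + i w) / (1 - i w)`. -/
def beta (w : ℂ) : ℂ := (1 + w * Complex.I) / (1 - w * Complex.I)

/-- The inverse map `β⁻¹ : 𝔻 → ℍ`, `β⁻¹(z) = i (1 - z) / (1 + z)`. -/
def betaInv (z : ℂ) : ℂ := Complex.I * ((1 - z) / (1 + z))

/-- The coloring matrix `Y = diag(1, …, 1, t)`, of size `n + 1`. -/
def coloring (n : ℕ) (t : ℝ) : Matrix (Fin (n + 1)) (Fin (n + 1)) ℂ :=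
  Matrix.diagonal fun i => if i = Fin.last n then (t : ℂ) else 1

/-- `f_A^t(w₁, w₂)`, the `(1,1)` entry of `(A - w₁ Y - w₂ (I - Y))⁻¹`, where `A` is the adjacency
matrix of the graph `G` on the `n + 1` vertices `0, …, n` (so the first vertex is `0`). -/
def fA {n : ℕ} (G : SimpleGraph (Fin (n + 1))) [DecidableRel G.Adj] (t : ℝ) (w₁ w₂ : ℂ) : ℂ :=
  (G.adjMatrix ℂ - w₁ • coloring n t - w₂ • (1 - coloring n t))⁻¹ 0 0

/-- `φ_A^t = β ∘ f_A^t ∘ β⁻¹`, on the bidisk `𝔻²` (where all the inverses involved exist). -/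
def phiA {n : ℕ} (G : SimpleGraph (Fin (n + 1))) [DecidableRel G.Adj] (t : ℝ) (z₁ z₂ : ℂ) : ℂ :=
  beta (fA G t (betaInv z₁) (betaInv z₂))

/-- The function `φ` on the bidisk is the rational function `q / p`, where the polynomials
`q` and `p` have no common factor. -/
structure IsReducedFraction (φ : ℂ → ℂ → ℂ) (q p : MvPolynomial (Fin 2) ℂ) : Prop where
  ne_zero : p ≠ 0
  isRelPrime : IsRelPrime q p
  mul_eq : ∀ z₁ z₂ : ℂ, ‖z₁‖ < 1 → ‖z₂‖ < 1 →
    φ z₁ z₂ * MvPolynomial.eval ![z₁, z₂] p = MvPolynomial.eval ![z₁, z₂] q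

/-- The reflection `p̃(z₁, z₂) = z₁ᵐ z₂ⁿ conj (p (1 / conj z₁, 1 / conj z₂))` of a polynomial `p`
of bidegree `(m, n)`, as a polynomial; see `eval_reflection`. -/
def reflection (p : MvPolynomial (Fin 2) ℂ) : MvPolynomial (Fin 2) ℂ :=
  ∑ s ∈ p.support, MvPolynomial.monomial
    (Finsupp.equivFunOnFinite.symm fun i => p.degreeOf i - s i) (starRingEnd ℂ (p.coeff s))

theorem eval_reflection (p : MvPolynomial (Fin 2) ℂ) (z₁ z₂ : ℂ) (h₁ : z₁ ≠ 0) (h₂ : z₂ ≠ 0) :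
    MvPolynomial.eval ![z₁, z₂] (reflection p) =
      z₁ ^ p.degreeOf 0 * z₂ ^ p.degreeOf 1 *
        starRingEnd ℂ (MvPolynomial.eval
          ![1 / starRingEnd ℂ z₁, 1 / starRingEnd ℂ z₂] p) := by
  rw [reflection, map_sum, MvPolynomial.eval_eq' _ p, map_sum, Finset.mul_sum]
  refine Finset.sum_congr rfl fun s hs => ?_
  have e₀ : s 0 ≤ p.degreeOf 0 := MvPolynomial.le_degreeOf_of_mem_support 0 hs
  have e₁ : s 1 ≤ p.degreeOf 1 := MvPolynomial.le_degreeOf_of_mem_support 1 hs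
  rw [MvPolynomial.eval_monomial, Finsupp.prod_fintype _ _ (fun i => pow_zero _)]
  simp only [Fin.prod_univ_two, Finsupp.equivFunOnFinite_symm_apply_apply, map_mul, map_pow,
    Matrix.cons_val_zero, Matrix.cons_val_one, map_div₀, map_one, Complex.conj_conj]
  rw [pow_sub₀ _ h₁ e₀, pow_sub₀ _ h₂ e₁, one_div, one_div, inv_pow, inv_pow]
  ring

/-- `K` is the contact order of the stable polynomial `p` at its zero `(τ₁, τ₂) ∈ 𝕋²`: for `z₁ ∈ 𝕋`
and `z₂ ∈ 𝔻` sufficiently close to `τ₁` and `τ₂`, the quantity `inf {1 - |z₂| : p̃(z₁, z₂) = 0}` is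
bounded above and below by positive multiples of `|τ₁ - z₁| ^ K`.

The point `z₁ = τ₁` is left out. The lower bound shows that the infimum is positive, hence it is not
taken over the empty set (whose infimum is `0` by convention). -/
def HasContactOrder (p : MvPolynomial (Fin 2) ℂ) (τ₁ τ₂ : ℂ) (K : ℕ) : Prop :=
  MvPolynomial.eval ![τ₁, τ₂] p = 0 ∧
    ∀ᶠ δ : ℝ in 𝓝[>] 0,
      (fun z₁ : ℂ => sInf {d : ℝ | ∃ z₂ : ℂ, ‖z₂‖ < 1 ∧ ‖τ₂ - z₂‖ < δ ∧
          MvPolynomial.eval ![z₁, z₂] (reflection p) = 0 ∧ d = 1 - ‖z₂‖})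
        =Θ[𝓝[{z : ℂ | ‖z‖ = 1 ∧ z ≠ τ₁}] τ₁] fun z₁ : ℂ => ‖τ₁ - z₁‖ ^ K

end GraphStable

end

open GraphStable

noncomputable section

namespace GraphStable

/-! Since Y_t = Y_0 + t (I - Y_0), passing from 0 to t replaces w₂ by t w₁ + (1 - t) w₂
(`fA_eq_fA_zero`). With M the matrix for t = 0, β((M⁻¹)₁₁) = det(M + iE₁₁) / det(M - iE₁₁). The
numerator is affine in w₂, say e(w₁) - w₂ h(w₁), and has no zero with both variables in the lower
half-plane; the denominator is its conjugate polynomial (`cornerDet_eq`,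
`beta_inv_colorPencil_mul`).

On the real line everything is governed by R = e/h, which satisfies Im R ≥ 0 wherever h ≠ 0. Where
R(x) is not real, the zeros of p̃(β(x), ·) away from 0 and -1 reduce to β(R(x)), and the factor r
lost in lowest terms does not interfere (`eval_reflection_eq_zero_iff`). Hence p vanishes at (β(x₁),
β(x₂)) exactly when, as x → x₁ with x ≠ x₁, R is eventually non-real and tends to x₂
(`eval_den_eq_zero_iff_hasRealLimit`). The contact order is then the order of vanishing of Im R at
x₁ (`hasContactOrder_iff`), a definite natural number because Im R is a rational function of x
(`HasRealLimit.exists_im_isTheta`).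

The shift turns R into (R - t x)/(1 - t). The limit x₂ becomes (x₂ - t x₁)/(1 - t), which is
β⁻¹(λ₂), and Im R is only divided by 1 - t (`realQuot_shift_im`), so its order of vanishing is
unchanged. -/

/-! ### The Cayley transform between the real line and the circle -/

theorem one_sub_mul_I_ne_zero {w : ℂ} (hw : -1 < w.im) : 1 - w * Complex.I ≠ 0 := by
  intro h
  have := congrArg Complex.re h
  simp at this
  linarith

theorem one_sub_ofReal_mul_I_ne_zero (x : ℝ) : 1 - (x : ℂ) * Complex.I ≠ 0 :=
  one_sub_mul_I_ne_zero (by simp)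

theorem one_add_ne_zero {z : ℂ} (hz : z ≠ -1) : 1 + z ≠ 0 :=
  fun h => hz (by linear_combination h)

theorem beta_betaInv {z : ℂ} (hz : z ≠ -1) : beta (betaInv z) = z := by
  have h := one_add_ne_zero hz
  have e : betaInv z * Complex.I = -((1 - z) / (1 + z)) := by
    rw [betaInv]; linear_combination ((1 - z) / (1 + z)) * Complex.I_mul_I
  rw [beta, e]
  have h2 : 1 - -((1 - z) / (1 + z)) = 2 / (1 + z) := by field_simp; ring
  rw [h2]
  field_simp
  ring

theorem betaInv_beta {w : ℂ} (hw : 1 - w * Complex.I ≠ 0) : betaInv (beta w) = w := by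
  have h1 : 1 + beta w = 2 / (1 - w * Complex.I) := by rw [beta]; field_simp; ring
  have h2 : 1 - beta w = -2 * w * Complex.I / (1 - w * Complex.I) := by
    rw [beta]; field_simp; ring
  rw [betaInv, h1, h2, div_div_div_cancel_right₀ hw]
  linear_combination -w * Complex.I_mul_I

theorem beta_ne_neg_one {w : ℂ} (hw : 1 - w * Complex.I ≠ 0) : beta w ≠ -1 := by
  intro h
  rw [beta, div_eq_iff hw] at h
  have : (2 : ℂ) = 0 := by linear_combination h
  norm_num at this

theorem one_sub_normSq_beta {w : ℂ} (hw : 1 - w * Complex.I ≠ 0) :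
    1 - ‖beta w‖ ^ 2 = 4 * w.im / ‖1 - w * Complex.I‖ ^ 2 := by
  have h : ‖1 - w * Complex.I‖ ^ 2 ≠ 0 := by simpa using hw
  rw [beta, norm_div, div_pow, eq_div_iff h, sub_mul, div_mul_cancel₀ _ h]
  rw [Complex.sq_norm, Complex.sq_norm, Complex.normSq_apply, Complex.normSq_apply]
  simp
  ring

theorem norm_beta_ofReal (x : ℝ) : ‖beta x‖ = 1 := by
  have h := one_sub_normSq_beta (one_sub_ofReal_mul_I_ne_zero x)
  simp only [Complex.ofReal_im, mul_zero, zero_div] at h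
  nlinarith [norm_nonneg (beta x)]

theorem betaInv_im (z : ℂ) : (betaInv z).im = (1 - ‖z‖ ^ 2) / ‖1 + z‖ ^ 2 := by
  rw [betaInv, Complex.I_mul_im, Complex.div_re, Complex.sq_norm, Complex.sq_norm,
    Complex.normSq_apply z, ← add_div]
  simp
  ring

theorem betaInv_im_pos {z : ℂ} (hz : ‖z‖ < 1) : 0 < (betaInv z).im := by
  have h1 : z ≠ -1 := by rintro rfl; simp at hz
  have h2 : 0 < ‖1 + z‖ := norm_pos_iff.2 (one_add_ne_zero h1)
  rw [betaInv_im]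
  have : ‖z‖ ^ 2 < 1 := by nlinarith [norm_nonneg z]
  have : 0 < 1 - ‖z‖ ^ 2 := by linarith
  positivity

theorem betaInv_eq_ofReal {z : ℂ} (hz : ‖z‖ = 1) : betaInv z = ((betaInv z).re : ℂ) := by
  apply Complex.ext
  · simp
  · rw [betaInv_im, hz]; simp

theorem betaInv_one_div_conj {z : ℂ} (h0 : z ≠ 0) (h1 : z ≠ -1) :
    betaInv (1 / starRingEnd ℂ z) = starRingEnd ℂ (betaInv z) := by
  have h0' : starRingEnd ℂ z ≠ 0 := by simpa using h0
  have h2 : 1 + starRingEnd ℂ z ≠ 0 := by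
    have := (map_ne_zero (starRingEnd ℂ)).2 (one_add_ne_zero h1)
    simpa using this
  have h3 : 1 + 1 / starRingEnd ℂ z ≠ 0 := by
    rw [show 1 + 1 / starRingEnd ℂ z = (1 + starRingEnd ℂ z) / starRingEnd ℂ z by
      field_simp; ring]
    exact div_ne_zero h2 h0'
  have h4 : starRingEnd ℂ z + 1 ≠ 0 := by rwa [add_comm]
  simp only [betaInv, map_mul, map_div₀, map_sub, map_add, map_one, Complex.conj_I]
  rw [show (1 - 1 / starRingEnd ℂ z) / (1 + 1 / starRingEnd ℂ z) =
    -((1 - starRingEnd ℂ z) / (1 + starRingEnd ℂ z)) by field_simp; ring]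
  ring

theorem continuousAt_beta {w : ℂ} (hw : 1 - w * Complex.I ≠ 0) : ContinuousAt beta w := by
  unfold beta
  exact ContinuousAt.div (by fun_prop) (by fun_prop) hw

theorem continuousAt_betaInv {z : ℂ} (hz : z ≠ -1) : ContinuousAt betaInv z := by
  unfold betaInv
  exact continuousAt_const.mul (ContinuousAt.div (by fun_prop) (by fun_prop) (one_add_ne_zero hz))

theorem continuous_beta_ofReal : Continuous fun x : ℝ => beta x :=
  continuous_iff_continuousAt.2 fun x =>
    ContinuousAt.comp (f := fun x : ℝ => (x : ℂ)) (continuousAt_beta (one_sub_ofReal_mul_I_ne_zero x))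
      Complex.continuous_ofReal.continuousAt

theorem betaInv_beta_ofReal (x : ℝ) : betaInv (beta x) = x :=
  betaInv_beta (one_sub_ofReal_mul_I_ne_zero x)

theorem beta_ofReal_ne_neg_one (x : ℝ) : beta x ≠ -1 :=
  beta_ne_neg_one (one_sub_ofReal_mul_I_ne_zero x)

theorem beta_ofReal_injective : Function.Injective fun x : ℝ => beta x := fun x y h => by
  have := congrArg betaInv h
  simpa only [betaInv_beta_ofReal, Complex.ofReal_inj] using this

/-- Transports asymptotics on the circle to the real line. An equality of filters is needed because
Θ-estimates must pass in both directions. -/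
theorem map_beta_nhdsNE (x₁ : ℝ) :
    map (fun x : ℝ => beta x) (𝓝[≠] x₁) =
      𝓝[{z : ℂ | ‖z‖ = 1 ∧ z ≠ beta x₁}] (beta x₁) := by
  set l' := 𝓝[{z : ℂ | ‖z‖ = 1 ∧ z ≠ beta x₁}] (beta x₁) with hl'
  have hmem : ∀ᶠ z in l', ‖z‖ = 1 ∧ z ≠ beta x₁ := eventually_mem_nhdsWithin
  have hne : ∀ᶠ z in l', z ≠ -1 :=
    nhdsWithin_le_nhds (isOpen_ne.mem_nhds (beta_ofReal_ne_neg_one x₁))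
  have hinv : ∀ᶠ z in l', beta ((betaInv z).re : ℝ) = z := by
    filter_upwards [hmem, hne] with z hz hz'
    rw [← betaInv_eq_ofReal hz.1, beta_betaInv hz']
  apply le_antisymm
  · refine tendsto_nhdsWithin_iff.2 ⟨?_, ?_⟩
    · exact (continuous_beta_ofReal.tendsto x₁).mono_left nhdsWithin_le_nhds
    · filter_upwards [self_mem_nhdsWithin] with x hx
      exact ⟨norm_beta_ofReal x, fun h => hx (beta_ofReal_injective h)⟩
  · have h1 : Tendsto (fun z => (betaInv z).re) l' (𝓝[≠] x₁) := by
      refine tendsto_nhdsWithin_iff.2 ⟨?_, ?_⟩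
      · have := (Complex.continuous_re.continuousAt.comp
          (continuousAt_betaInv (beta_ofReal_ne_neg_one x₁))).tendsto.mono_left
            (nhdsWithin_le_nhds (s := {z : ℂ | ‖z‖ = 1 ∧ z ≠ beta x₁}))
        simpa [Function.comp_def, betaInv_beta_ofReal] using this
      · filter_upwards [hmem, hinv] with z hz hz' h
        exact hz.2 (by rw [← hz', Set.mem_singleton_iff.1 h])
    calc l' = map id l' := map_id.symm
      _ = map (fun z => beta ((betaInv z).re : ℝ)) l' := map_congr (hinv.mono fun z hz => hz.symm)
      _ = map (fun x : ℝ => beta x) (map (fun z => (betaInv z).re) l') := by rw [map_map]; rfl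
      _ ≤ _ := map_mono h1

theorem isTheta_one_of_tendsto {α : Type*} {l : Filter α} {f : α → ℝ} {c : ℝ}
    (h : Tendsto f l (𝓝 c)) (hc : c ≠ 0) : f =Θ[l] fun _ => (1 : ℝ) :=
  (isTheta_of_div_tendsto_nhds_ne_zero (by simpa using h) hc).symm

theorem norm_beta_sub_beta_isTheta (x₁ : ℝ) :
    (fun x : ℝ => ‖beta x₁ - beta x‖) =Θ[𝓝[≠] x₁] fun x => |x - x₁| := by
  have h : ∀ x : ℝ, ‖beta x₁ - beta x‖ =
      2 / (‖1 - (x₁ : ℂ) * Complex.I‖ * ‖1 - (x : ℂ) * Complex.I‖) * |x - x₁| := by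
    intro x
    have h1 := one_sub_ofReal_mul_I_ne_zero x₁
    have h2 := one_sub_ofReal_mul_I_ne_zero x
    have : beta x₁ - beta x = -2 * Complex.I /
        ((1 - (x₁ : ℂ) * Complex.I) * (1 - (x : ℂ) * Complex.I)) * ((x - x₁ : ℝ) : ℂ) := by
      rw [beta, beta, div_sub_div _ _ h1 h2, div_mul_eq_mul_div]
      push_cast
      congr 1
      ring
    rw [this, norm_mul, Complex.norm_real]
    simp
  have h1 : (fun x : ℝ => 2 / (‖1 - (x₁ : ℂ) * Complex.I‖ * ‖1 - (x : ℂ) * Complex.I‖))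
      =Θ[𝓝[≠] x₁] fun _ => (1 : ℝ) := by
    have hn : ‖1 - (x₁ : ℂ) * Complex.I‖ ≠ 0 := norm_ne_zero_iff.2 (one_sub_ofReal_mul_I_ne_zero x₁)
    have hc : ContinuousAt
        (fun x : ℝ => 2 / (‖1 - (x₁ : ℂ) * Complex.I‖ * ‖1 - (x : ℂ) * Complex.I‖)) x₁ :=
      ContinuousAt.div continuousAt_const (by fun_prop) (mul_ne_zero hn hn)
    exact isTheta_one_of_tendsto (hc.tendsto.mono_left nhdsWithin_le_nhds)
      (div_ne_zero two_ne_zero (mul_ne_zero hn hn))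
  simp_rw [h]
  simpa using h1.mul (isTheta_refl (fun x : ℝ => |x - x₁|) (𝓝[≠] x₁))

/-! ### Pullback of pencils to polynomials on the bidisk -/

/-- The homogenized pullback of a polynomial under `betaInv`, as a polynomial in `z₁` alone. -/
def cleared (e : Polynomial ℂ) (m : ℕ) : MvPolynomial (Fin 2) ℂ :=
  ∑ k ∈ Finset.range (m + 1), MvPolynomial.C (e.coeff k) *
    (MvPolynomial.C Complex.I * (1 - MvPolynomial.X 0)) ^ k * (1 + MvPolynomial.X 0) ^ (m - k)

theorem eval_cleared {e : Polynomial ℂ} {m : ℕ} (he : e.natDegree ≤ m) {z₁ : ℂ} (z₂ : ℂ)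
    (h₁ : z₁ ≠ -1) :
    MvPolynomial.eval ![z₁, z₂] (cleared e m) = (1 + z₁) ^ m * e.eval (betaInv z₁) := by
  have h := one_add_ne_zero h₁
  rw [cleared, Polynomial.eval_eq_sum_range' (Nat.lt_succ_of_le he), map_sum, Finset.mul_sum]
  refine Finset.sum_congr rfl fun k hk => ?_
  have hk' : k ≤ m := Nat.lt_succ_iff.1 (Finset.mem_range.1 hk)
  simp only [map_mul, map_pow, MvPolynomial.eval_C, MvPolynomial.eval_X, map_sub, map_add, map_one,
    Matrix.cons_val_zero]
  rw [betaInv, pow_sub₀ _ h hk', mul_pow, mul_pow, div_pow]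
  field_simp

theorem degreeOf_cleared (e : Polynomial ℂ) (m : ℕ) : (cleared e m).degreeOf 1 = 0 := by
  have h : cleared e m ∈ MvPolynomial.supported ℂ ({0} : Set (Fin 2)) := by
    have hC : ∀ c : ℂ, MvPolynomial.C c ∈ MvPolynomial.supported ℂ ({0} : Set (Fin 2)) :=
      fun c => (MvPolynomial.supported ℂ ({0} : Set (Fin 2))).algebraMap_mem c
    have hX : (MvPolynomial.X 0 : MvPolynomial (Fin 2) ℂ) ∈
        MvPolynomial.supported ℂ ({0} : Set (Fin 2)) := MvPolynomial.X_mem_supported.2 rfl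
    exact Subalgebra.sum_mem _ fun k _ => mul_mem (mul_mem (hC _)
      (pow_mem (mul_mem (hC _) (sub_mem (one_mem _) hX)) _))
      (pow_mem (add_mem (one_mem _) hX) _)
  by_contra hne
  have := MvPolynomial.mem_supported.1 h
    (Finset.mem_coe.2 (MvPolynomial.mem_vars_iff_degreeOf_ne_zero.2 hne))
  simp at this

/-- The homogenized pullback of `e(w₁) - w₂ h(w₁)` under `betaInv` in both variables. -/
def pencil (e h : Polynomial ℂ) (m : ℕ) : MvPolynomial (Fin 2) ℂ :=
  (1 + MvPolynomial.X 1) * cleared e m -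
    MvPolynomial.C Complex.I * (1 - MvPolynomial.X 1) * cleared h m

theorem eval_pencil {e h : Polynomial ℂ} {m : ℕ} (he : e.natDegree ≤ m) (hh : h.natDegree ≤ m)
    {z₁ z₂ : ℂ} (h₁ : z₁ ≠ -1) (h₂ : z₂ ≠ -1) :
    MvPolynomial.eval ![z₁, z₂] (pencil e h m) = (1 + z₁) ^ m * (1 + z₂) *
      (e.eval (betaInv z₁) - betaInv z₂ * h.eval (betaInv z₁)) := by
  have h' := one_add_ne_zero h₂
  simp only [pencil, map_sub, map_mul, map_add, map_one, MvPolynomial.eval_C, MvPolynomial.eval_X,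
    Matrix.cons_val_one, eval_cleared he _ h₁, eval_cleared hh _ h₁]
  rw [betaInv.eq_def z₂]
  simp only [Matrix.cons_val_fin_one]
  field_simp

theorem degreeOf_pencil_le (e h : Polynomial ℂ) (m : ℕ) : (pencil e h m).degreeOf 1 ≤ 1 := by
  have hX : (MvPolynomial.X 1 : MvPolynomial (Fin 2) ℂ).degreeOf 1 ≤ 1 := by
    simp
  have h1 : (1 : MvPolynomial (Fin 2) ℂ).degreeOf 1 = 0 := MvPolynomial.degreeOf_C 1 1
  refine (MvPolynomial.degreeOf_sub_le _ _ _).trans (max_le ?_ ?_)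
  · refine (MvPolynomial.degreeOf_mul_le _ _ _).trans ?_
    have := MvPolynomial.degreeOf_add_le 1 (1 : MvPolynomial (Fin 2) ℂ) (MvPolynomial.X 1)
    rw [degreeOf_cleared]
    omega
  · refine (MvPolynomial.degreeOf_mul_le _ _ _).trans ?_
    have := MvPolynomial.degreeOf_sub_le 1 (1 : MvPolynomial (Fin 2) ℂ) (MvPolynomial.X 1)
    have := MvPolynomial.degreeOf_C_mul_le (1 - MvPolynomial.X 1 : MvPolynomial (Fin 2) ℂ) 1
      Complex.I
    rw [degreeOf_cleared]
    omega

/-! ### Bivariate polynomials on the lines z₁ = τ -/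

theorem eval_eq_of_degreeOf_le_one {p : MvPolynomial (Fin 2) ℂ} (hp : p.degreeOf 1 ≤ 1)
    (z u : ℂ) : MvPolynomial.eval ![z, u] p = MvPolynomial.eval ![z, 0] p +
      u * (MvPolynomial.eval ![z, 1] p - MvPolynomial.eval ![z, 0] p) := by
  simp only [MvPolynomial.eval_eq']
  rw [← Finset.sum_sub_distrib, Finset.mul_sum, ← Finset.sum_add_distrib]
  refine Finset.sum_congr rfl fun s hs => ?_
  have e₁ : s 1 ≤ 1 := (MvPolynomial.le_degreeOf_of_mem_support 1 hs).trans hp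
  simp only [Fin.prod_univ_two, Matrix.cons_val_zero, Matrix.cons_val_one]
  interval_cases h : s 1 <;> simp; ring

theorem eval_eq_of_degreeOf_eq_zero {p : MvPolynomial (Fin 2) ℂ} (hp : p.degreeOf 1 = 0)
    (z u v : ℂ) : MvPolynomial.eval ![z, u] p = MvPolynomial.eval ![z, v] p := by
  simp only [MvPolynomial.eval_eq']
  refine Finset.sum_congr rfl fun s hs => ?_
  have e₁ : s 1 = 0 :=
    Nat.le_zero.1 ((MvPolynomial.le_degreeOf_of_mem_support 1 hs).trans hp.le)
  simp [Fin.prod_univ_two, e₁]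

/-- The factor theorem in the first variable, with coefficients in the polynomial ring of the
second. -/
theorem X_sub_C_dvd_of_eval_eq_zero {p : MvPolynomial (Fin 2) ℂ} {τ : ℂ}
    (h : ∀ u, MvPolynomial.eval ![τ, u] p = 0) :
    MvPolynomial.X 0 - MvPolynomial.C τ ∣ p := by
  have h1 : Polynomial.eval (MvPolynomial.C τ) (MvPolynomial.finSuccEquiv ℂ 1 p) = 0 := by
    apply MvPolynomial.funext
    intro x
    rw [MvPolynomial.eval_polynomial_eval_finSuccEquiv, map_zero, ← h (x 0)]
    congr 2
    funext i
    refine Fin.cases (by simp) (fun j => ?_) i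
    fin_cases j
    rfl
  obtain ⟨s, hs⟩ := Polynomial.dvd_iff_isRoot.2 h1
  refine ⟨(MvPolynomial.finSuccEquiv ℂ 1).symm s, ?_⟩
  apply (MvPolynomial.finSuccEquiv ℂ 1).injective
  rw [hs, map_mul, AlgEquiv.apply_symm_apply, map_sub, MvPolynomial.finSuccEquiv_X_zero]
  congr 2
  exact ((MvPolynomial.finSuccEquiv ℂ 1).commutes τ).symm

theorem not_isRelPrime_of_eval_eq_zero {q p : MvPolynomial (Fin 2) ℂ} {τ : ℂ}
    (hq : ∀ u, MvPolynomial.eval ![τ, u] q = 0) (hp : ∀ u, MvPolynomial.eval ![τ, u] p = 0) :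
    ¬ IsRelPrime q p := by
  intro h
  have := (h (X_sub_C_dvd_of_eval_eq_zero hq) (X_sub_C_dvd_of_eval_eq_zero hp)).map
    (MvPolynomial.eval ![τ, 0])
  simp at this

theorem eval_eq_zero_of_infinite {p : MvPolynomial (Fin 2) ℂ} {τ : ℂ} {S : Set ℂ}
    (hS : S.Infinite) (h : ∀ u ∈ S, MvPolynomial.eval ![τ, u] p = 0) (u : ℂ) :
    MvPolynomial.eval ![τ, u] p = 0 := by
  have key : ∀ v, (MvPolynomial.aeval ![Polynomial.C τ, Polynomial.X] p).eval v =
      MvPolynomial.eval ![τ, v] p := by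
    intro v
    rw [← Polynomial.coe_evalRingHom, MvPolynomial.aeval_def, MvPolynomial.hom_eval₂,
      MvPolynomial.eval, MvPolynomial.coe_eval₂Hom]
    congr 1
    · ext; simp
    · funext i; fin_cases i <;> simp
  have h0 := Polynomial.eq_zero_of_infinite_isRoot _
    (hS.mono fun v hv => show Polynomial.IsRoot _ v from (key v).trans (h v hv))
  rw [← key, h0, Polynomial.eval_zero]

/-! ### Conjugate pencils and reduction to lowest terms -/

/-- The complex conjugate of a polynomial. -/
def conjPoly (e : Polynomial ℂ) : Polynomial ℂ := e.map (starRingEnd ℂ)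

theorem eval_conjPoly_conj (e : Polynomial ℂ) (w : ℂ) :
    (conjPoly e).eval (starRingEnd ℂ w) = starRingEnd ℂ (e.eval w) :=
  Polynomial.eval_map_apply (f := starRingEnd ℂ) w

theorem eval_conjPoly_ofReal (e : Polynomial ℂ) (x : ℝ) :
    (conjPoly e).eval (x : ℂ) = starRingEnd ℂ (e.eval (x : ℂ)) := by
  rw [← eval_conjPoly_conj, Complex.conj_ofReal]

theorem natDegree_conjPoly_le (e : Polynomial ℂ) : (conjPoly e).natDegree ≤ e.natDegree :=
  Polynomial.natDegree_map_le

theorem eventually_eval_ne_zero {p : Polynomial ℂ} (hp : p ≠ 0) (x₁ : ℝ) :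
    ∀ᶠ x : ℝ in 𝓝[≠] x₁, p.eval (x : ℂ) ≠ 0 := by
  have hfin : {x : ℝ | p.eval (x : ℂ) = 0}.Finite := by
    have := Polynomial.finite_setOfPred_isRoot hp
    exact this.preimage (f := fun x : ℝ => (x : ℂ)) Complex.ofReal_injective.injOn
  have h1 : ({x : ℝ | p.eval (x : ℂ) = 0} \ {x₁})ᶜ ∈ 𝓝 x₁ :=
    (hfin.subset Set.sdiff_subset).isClosed.isOpen_compl.mem_nhds (by simp)
  filter_upwards [nhdsWithin_le_nhds h1, self_mem_nhdsWithin] with x hx hx' h0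
  exact hx ⟨h0, hx'⟩

/-- The quotient `e / h` on the real line. -/
def realQuot (e h : Polynomial ℂ) (x : ℝ) : ℂ := e.eval (x : ℂ) / h.eval (x : ℂ)

/-- Non-vanishing of `e(w₁) - w₂ h(w₁)` on the product of two lower half-planes. -/
def LowerNonvanishing (e h : Polynomial ℂ) : Prop :=
  ∀ w₁ w₂ : ℂ, w₁.im < 0 → w₂.im < 0 → e.eval w₁ - w₂ * h.eval w₁ ≠ 0

/-- The fraction `q / p` is obtained from the pencil of `e`, `h` and its conjugate by cancelling
a common factor `r`. -/
structure IsPencilFraction (e h : Polynomial ℂ) (q p r : MvPolynomial (Fin 2) ℂ) (m : ℕ) :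
    Prop where
  natDegree_left : e.natDegree ≤ m
  natDegree_right : h.natDegree ≤ m
  nonvanishing : LowerNonvanishing e h
  isRelPrime : IsRelPrime q p
  num : pencil e h m = q * r
  den : pencil (conjPoly e) (conjPoly h) m = p * r

theorem LowerNonvanishing.conj {e h : Polynomial ℂ} (H : LowerNonvanishing e h) {w₁ w₂ : ℂ}
    (h₁ : 0 < w₁.im) (h₂ : 0 < w₂.im) :
    (conjPoly e).eval w₁ - w₂ * (conjPoly h).eval w₁ ≠ 0 := by
  have := H (starRingEnd ℂ w₁) (starRingEnd ℂ w₂) (by simpa) (by simpa)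
  rw [← map_ne_zero (starRingEnd ℂ), map_sub, map_mul, ← eval_conjPoly_conj,
    ← eval_conjPoly_conj] at this
  simpa using this

theorem ne_neg_one_of_norm_lt {z : ℂ} (hz : ‖z‖ < 1) : z ≠ -1 := by
  rintro rfl
  simp at hz

/-- Cross-multiplying gives an identity on the bidisk, hence between polynomials; coprimality of q
and p then makes p divide the conjugate pencil. -/
theorem IsReducedFraction.exists_isPencilFraction {e h : Polynomial ℂ}
    (H : LowerNonvanishing e h) {φ : ℂ → ℂ → ℂ} {q p : MvPolynomial (Fin 2) ℂ}
    (hqp : IsReducedFraction φ q p)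
    (hφ : ∀ z₁ z₂ : ℂ, ‖z₁‖ < 1 → ‖z₂‖ < 1 → φ z₁ z₂ *
      ((conjPoly e).eval (betaInv z₁) - betaInv z₂ * (conjPoly h).eval (betaInv z₁)) =
        e.eval (betaInv z₁) - betaInv z₂ * h.eval (betaInv z₁)) :
    ∃ r m, IsPencilFraction e h q p r m := by
  set m := max e.natDegree h.natDegree
  have he : e.natDegree ≤ m := le_max_left _ _
  have hh : h.natDegree ≤ m := le_max_right _ _
  have he' := (natDegree_conjPoly_le e).trans he
  have hh' := (natDegree_conjPoly_le h).trans hh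
  have key : q * pencil (conjPoly e) (conjPoly h) m = pencil e h m * p := by
    refine MvPolynomial.funext_set (fun _ => Metric.ball (0 : ℂ) 1)
      (fun _ => infinite_of_mem_nhds 0 (Metric.ball_mem_nhds 0 one_pos)) fun x hx => ?_
    have h1 : ‖x 0‖ < 1 := by simpa using hx 0 trivial
    have h2 : ‖x 1‖ < 1 := by simpa using hx 1 trivial
    have hx' : x = ![x 0, x 1] := by funext i; fin_cases i <;> rfl
    rw [hx', map_mul, map_mul, ← hqp.mul_eq _ _ h1 h2,
      eval_pencil he' hh' (ne_neg_one_of_norm_lt h1) (ne_neg_one_of_norm_lt h2),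
      eval_pencil he hh (ne_neg_one_of_norm_lt h1) (ne_neg_one_of_norm_lt h2), ← hφ _ _ h1 h2]
    ring
  obtain ⟨r, hr⟩ : p ∣ pencil (conjPoly e) (conjPoly h) m :=
    hqp.isRelPrime.symm.dvd_of_dvd_mul_left (key ▸ dvd_mul_left p _)
  refine ⟨r, m, he, hh, H, hqp.isRelPrime, ?_, hr⟩
  apply mul_right_cancel₀ hqp.ne_zero
  rw [← key, hr]
  ring

theorem right_ne_zero_of_realQuot_im_ne_zero {e h : Polynomial ℂ} {x : ℝ}
    (hx : (realQuot e h x).im ≠ 0) : h.eval (x : ℂ) ≠ 0 := by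
  intro h0
  simp [realQuot, h0] at hx

theorem continuous_eval_pair (p : MvPolynomial (Fin 2) ℂ) :
    Continuous fun z : ℂ × ℂ => MvPolynomial.eval ![z.1, z.2] p := by
  refine (MvPolynomial.continuous_eval p).comp (continuous_pi fun i => ?_)
  fin_cases i
  · exact continuous_fst
  · exact continuous_snd

theorem LowerNonvanishing.realQuot_im_nonneg {e h : Polynomial ℂ} (H : LowerNonvanishing e h)
    {x : ℝ} (hx : h.eval (x : ℂ) ≠ 0) : 0 ≤ (realQuot e h x).im := by
  set w : ℝ → ℂ := fun ε => (x : ℂ) - ε * Complex.I with hw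
  have hwc : ContinuousAt w 0 := by fun_prop
  have hw0 : w 0 = x := by simp [hw]
  have hh : ContinuousAt (fun ε => h.eval (w ε)) 0 :=
    ContinuousAt.comp (f := w) h.continuous.continuousAt hwc
  have he : ContinuousAt (fun ε => e.eval (w ε)) 0 :=
    ContinuousAt.comp (f := w) e.continuous.continuousAt hwc
  have hg : ContinuousAt (fun ε => (e.eval (w ε) / h.eval (w ε)).im) 0 :=
    Complex.continuous_im.continuousAt.comp (he.div hh (by rwa [hw0]))
  have hlim := hg.tendsto.mono_left (nhdsWithin_le_nhds (s := Set.Ioi 0))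
  rw [hw0] at hlim
  refine ge_of_tendsto hlim ?_
  have hne : ∀ᶠ ε in 𝓝[>] (0 : ℝ), h.eval (w ε) ≠ 0 :=
    nhdsWithin_le_nhds (hh.eventually_ne (by rwa [hw0]))
  filter_upwards [hne, self_mem_nhdsWithin] with ε h1 h2
  -- Otherwise w₂ = e/h at a point just below x is a zero of the pencil in the forbidden region.
  by_contra! hlt
  refine H (w ε) _ (by simpa [hw] using h2) hlt ?_
  rw [div_mul_cancel₀ _ h1, sub_self]

/-! ### Zeros of the reduced denominator -/

namespace IsPencilFraction

variable {e h : Polynomial ℂ} {q p r : MvPolynomial (Fin 2) ℂ} {m : ℕ}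

theorem eval_den_mul (H : IsPencilFraction e h q p r m) (x : ℝ) {u : ℂ} (hu : u ≠ -1) :
    MvPolynomial.eval ![beta x, u] p * MvPolynomial.eval ![beta x, u] r =
      (1 + beta x) ^ m * (1 + u) *
        (starRingEnd ℂ (e.eval (x : ℂ)) - betaInv u * starRingEnd ℂ (h.eval (x : ℂ))) := by
  rw [← map_mul, ← H.den, eval_pencil ((natDegree_conjPoly_le e).trans H.natDegree_left)
    ((natDegree_conjPoly_le h).trans H.natDegree_right) (beta_ofReal_ne_neg_one x) hu,
    betaInv_beta_ofReal, eval_conjPoly_ofReal, eval_conjPoly_ofReal]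

theorem eval_num_mul (H : IsPencilFraction e h q p r m) (x : ℝ) {u : ℂ} (hu : u ≠ -1) :
    MvPolynomial.eval ![beta x, u] q * MvPolynomial.eval ![beta x, u] r =
      (1 + beta x) ^ m * (1 + u) * (e.eval (x : ℂ) - betaInv u * h.eval (x : ℂ)) := by
  rw [← map_mul, ← H.num, eval_pencil H.natDegree_left H.natDegree_right
    (beta_ofReal_ne_neg_one x) hu, betaInv_beta_ofReal]

theorem den_ne_zero (H : IsPencilFraction e h q p r m) :
    pencil (conjPoly e) (conjPoly h) m ≠ 0 := by
  intro h0
  have h1 : (0 : ℂ) ≠ -1 := by norm_num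
  have := eval_pencil ((natDegree_conjPoly_le e).trans H.natDegree_left)
    ((natDegree_conjPoly_le h).trans H.natDegree_right) h1 h1
  rw [h0, map_zero] at this
  refine H.nonvanishing.conj (betaInv_im_pos (z := 0) (by simp)) (betaInv_im_pos (z := 0) (by simp))
    ?_
  simpa using this.symm

theorem eval_den_eq_zero_iff (H : IsPencilFraction e h q p r m) {x : ℝ}
    (hx : (realQuot e h x).im ≠ 0) {u : ℂ} (hu : u ≠ -1) :
    MvPolynomial.eval ![beta x, u] p = 0 ↔ betaInv u = starRingEnd ℂ (realQuot e h x) := by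
  have hh := right_ne_zero_of_realQuot_im_ne_zero hx
  have hh' : starRingEnd ℂ (h.eval (x : ℂ)) ≠ 0 := by simpa using hh
  have hne : (1 + beta x) ^ m * (1 + u) ≠ 0 :=
    mul_ne_zero (pow_ne_zero _ (one_add_ne_zero (beta_ofReal_ne_neg_one x))) (one_add_ne_zero hu)
  have hden := H.eval_den_mul x hu
  constructor
  · intro hp
    rw [hp, zero_mul] at hden
    rw [realQuot, map_div₀, eq_div_iff hh']
    exact (sub_eq_zero.1 ((mul_eq_zero.1 hden.symm).resolve_left hne)).symm
  · intro hw
    have h0 : starRingEnd ℂ (e.eval (x : ℂ)) - betaInv u * starRingEnd ℂ (h.eval (x : ℂ)) = 0 := by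
      rw [hw, realQuot, map_div₀, div_mul_cancel₀ _ hh', sub_self]
    rw [h0, mul_zero] at hden
    -- A zero of r here would kill both the pencil and its conjugate, so that R(x) equals its own
    -- conjugate.
    refine (mul_eq_zero.1 hden).resolve_right fun hr => hx ?_
    have hnum := H.eval_num_mul x hu
    rw [hr, mul_zero] at hnum
    have h1 : betaInv u = realQuot e h x := by
      rw [realQuot, eq_div_iff hh]
      exact (sub_eq_zero.1 ((mul_eq_zero.1 hnum.symm).resolve_left hne)).symm
    exact Complex.conj_eq_iff_im.1 (hw.symm.trans h1)

theorem norm_eval_num_eq (H : IsPencilFraction e h q p r m) {x y : ℝ}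
    (hxy : e.eval (x : ℂ) - y * h.eval (x : ℂ) ≠ 0) :
    ‖MvPolynomial.eval ![beta x, beta y] q‖ = ‖MvPolynomial.eval ![beta x, beta y] p‖ := by
  have hnum := H.eval_num_mul x (beta_ofReal_ne_neg_one y)
  have hden := H.eval_den_mul x (beta_ofReal_ne_neg_one y)
  rw [betaInv_beta_ofReal] at hnum hden
  have hne : (1 + beta x) ^ m * (1 + beta y) ≠ 0 :=
    mul_ne_zero (pow_ne_zero _ (one_add_ne_zero (beta_ofReal_ne_neg_one x)))
      (one_add_ne_zero (beta_ofReal_ne_neg_one y))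
  have hr : MvPolynomial.eval ![beta x, beta y] r ≠ 0 := by
    intro h0
    rw [h0, mul_zero] at hnum
    exact mul_ne_zero hne hxy hnum.symm
  have hc : starRingEnd ℂ (e.eval (x : ℂ)) - y * starRingEnd ℂ (h.eval (x : ℂ)) =
      starRingEnd ℂ (e.eval (x : ℂ) - y * h.eval (x : ℂ)) := by simp
  rw [hc] at hden
  apply mul_right_cancel₀ (norm_ne_zero_iff.2 hr)
  rw [← norm_mul, ← norm_mul, hnum, hden, norm_mul, norm_mul _ (starRingEnd ℂ _), RCLike.norm_conj]

/-- At real points the two pencils have equal modulus, hence so do q and p wherever r does not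
vanish. By continuity, a line z₁ = β(x₁) of zeros of p would also consist of zeros of q,
contradicting coprimality. -/
theorem exists_eval_den_ne_zero (H : IsPencilFraction e h q p r m) (x₁ : ℝ) :
    ∃ u, MvPolynomial.eval ![beta x₁, u] p ≠ 0 := by
  by_contra! hall
  refine not_isRelPrime_of_eval_eq_zero (fun u => ?_) hall H.isRelPrime
  -- At most one real y makes e - y h the zero polynomial; every other y can serve in the limiting
  -- argument.
  have hS : {y : ℝ | e - Polynomial.C (y : ℂ) * h = 0}.Subsingleton := by
    intro y hy y' hy'
    by_contra hne
    simp only [Set.mem_ofPred_eq] at hy hy'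
    have h1 : Polynomial.C ((y - y' : ℝ) : ℂ) * h = 0 := by
      push_cast
      rw [map_sub]
      linear_combination hy' - hy
    have h2 : h = 0 := by
      refine (mul_eq_zero.1 h1).resolve_left ?_
      simpa [sub_eq_zero] using hne
    have h3 : e = 0 := by simpa [h2] using hy
    refine H.nonvanishing (-Complex.I) (-Complex.I) (by simp) (by simp) ?_
    simp [h2, h3]
  refine eval_eq_zero_of_infinite
    ((hS.finite.infinite_compl).image (f := fun y : ℝ => beta y) beta_ofReal_injective.injOn) ?_ u
  rintro _ ⟨y, hy, rfl⟩
  have hev : ∀ᶠ x : ℝ in 𝓝[≠] x₁, ‖MvPolynomial.eval ![beta x, beta y] q‖ =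
      ‖MvPolynomial.eval ![beta x, beta y] p‖ := by
    filter_upwards [eventually_eval_ne_zero hy x₁] with x hx
    exact H.norm_eval_num_eq (by simpa using hx)
  have hlim : ∀ s : MvPolynomial (Fin 2) ℂ,
      Tendsto (fun x : ℝ => ‖MvPolynomial.eval ![beta x, beta y] s‖) (𝓝[≠] x₁)
        (𝓝 ‖MvPolynomial.eval ![beta x₁, beta y] s‖) := fun s =>
    (((continuous_eval_pair s).comp
      (continuous_beta_ofReal.prodMk continuous_const)).norm.tendsto x₁).mono_left
        nhdsWithin_le_nhds
  have := tendsto_nhds_unique ((hlim q).congr' hev) (hlim p)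
  simpa [hall] using this

/-- If R were real on the whole real line, q/p would not depend on z₂, so p would have degree 0 in
z₂. A single zero of p would then spread to an entire line z₁ = β(x₁). -/
theorem cross_ne_zero (H : IsPencilFraction e h q p r m) {x₁ : ℝ} {u₁ : ℂ}
    (hp : MvPolynomial.eval ![beta x₁, u₁] p = 0) :
    e * conjPoly h - conjPoly e * h ≠ 0 := by
  intro h0
  -- Up to powers of 1 + z₁, these are the two pencils at w₂ = i; the upper half-plane value
  -- guarantees p₀ ≠ 0.
  set q₀ := cleared e m - MvPolynomial.C Complex.I * cleared h m with hq₀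
  set p₀ := cleared (conjPoly e) m - MvPolynomial.C Complex.I * cleared (conjPoly h) m with hp₀
  have he' := (natDegree_conjPoly_le e).trans H.natDegree_left
  have hh' := (natDegree_conjPoly_le h).trans H.natDegree_right
  have hr : r ≠ 0 := fun hr => H.den_ne_zero (by rw [H.den, hr, mul_zero])
  have hcross : p * q₀ = q * p₀ := by
    apply mul_right_cancel₀ hr
    have h1 : (pencil (conjPoly e) (conjPoly h) m) * q₀ = pencil e h m * p₀ := by
      refine MvPolynomial.funext_set (fun _ => Metric.ball (0 : ℂ) 1)
        (fun _ => infinite_of_mem_nhds 0 (Metric.ball_mem_nhds 0 one_pos)) fun x hx => ?_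
      have h1 : x 0 ≠ -1 := ne_neg_one_of_norm_lt (by simpa using hx 0 trivial)
      have h2 : x 1 ≠ -1 := ne_neg_one_of_norm_lt (by simpa using hx 1 trivial)
      have hx' : x = ![x 0, x 1] := by funext i; fin_cases i <;> rfl
      have h3 := congrArg (Polynomial.eval (betaInv (x 0))) h0
      simp only [Polynomial.eval_sub, Polynomial.eval_mul, Polynomial.eval_zero] at h3
      rw [hx', map_mul, map_mul, eval_pencil he' hh' h1 h2,
        eval_pencil H.natDegree_left H.natDegree_right h1 h2, hq₀, hp₀]
      simp only [map_sub, map_mul, MvPolynomial.eval_C, eval_cleared he' _ h1,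
        eval_cleared hh' _ h1, eval_cleared H.natDegree_left _ h1,
        eval_cleared H.natDegree_right _ h1]
      linear_combination ((1 + x 0) ^ m * (1 + x 0) ^ m * (1 + x 1) *
        (Complex.I - betaInv (x 1))) * h3
    linear_combination h1 - q₀ * H.den + p₀ * H.num
  have hp₀ne : p₀ ≠ 0 := by
    intro hz
    have h1 : (0 : ℂ) ≠ -1 := by norm_num
    have := congrArg (MvPolynomial.eval ![0, 0]) hz
    simp only [hp₀, map_sub, map_mul, MvPolynomial.eval_C, eval_cleared he' _ h1,
        eval_cleared hh' _ h1, map_zero] at this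
    refine H.nonvanishing.conj (betaInv_im_pos (z := 0) (by simp)) (w₂ := Complex.I) (by simp) ?_
    simpa using this
  obtain ⟨s, hs⟩ : p ∣ p₀ :=
    H.isRelPrime.symm.dvd_of_dvd_mul_left (hcross ▸ dvd_mul_right p _)
  have hdeg : p₀.degreeOf 1 = 0 := by
    refine Nat.le_zero.1 ((MvPolynomial.degreeOf_sub_le _ _ _).trans (max_le ?_ ?_))
    · exact (degreeOf_cleared _ _).le
    · exact (MvPolynomial.degreeOf_C_mul_le _ _ _).trans (degreeOf_cleared _ _).le
  rw [hs, MvPolynomial.degreeOf_mul_eq (left_ne_zero_of_mul (hs ▸ hp₀ne))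
    (right_ne_zero_of_mul (hs ▸ hp₀ne))] at hdeg
  obtain ⟨u, hu⟩ := H.exists_eval_den_ne_zero x₁
  exact hu ((eval_eq_of_degreeOf_eq_zero (by omega) _ u u₁).trans hp)

theorem degreeOf_den_le (H : IsPencilFraction e h q p r m) : p.degreeOf 1 ≤ 1 := by
  have h1 := degreeOf_pencil_le (conjPoly e) (conjPoly h) m
  have h2 := H.den_ne_zero
  rw [H.den] at h1 h2
  rw [MvPolynomial.degreeOf_mul_eq (left_ne_zero_of_mul h2) (right_ne_zero_of_mul h2)] at h1
  omega

end IsPencilFraction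

/-! ### Boundary zeros as real limits of e/h -/

/-- The quotient of `e` and `h` is non-real near `x₁` and extends continuously to `x₁` with the real
value `x₂`. -/
def HasRealLimit (e h : Polynomial ℂ) (x₁ x₂ : ℝ) : Prop :=
  (∀ᶠ x in 𝓝[≠] x₁, (realQuot e h x).im ≠ 0) ∧ Tendsto (realQuot e h) (𝓝[≠] x₁) (𝓝 (x₂ : ℂ))

theorem HasRealLimit.tendsto_beta {e h : Polynomial ℂ} {x₁ x₂ : ℝ} (H : HasRealLimit e h x₁ x₂) :
    Tendsto (fun x => beta (realQuot e h x)) (𝓝[≠] x₁) (𝓝 (beta x₂)) :=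
  (continuousAt_beta (one_sub_ofReal_mul_I_ne_zero x₂)).tendsto.comp H.2

theorem HasRealLimit.eventually_im_pos {e h : Polynomial ℂ} {x₁ x₂ : ℝ}
    (H : HasRealLimit e h x₁ x₂) (hn : LowerNonvanishing e h) :
    ∀ᶠ x in 𝓝[≠] x₁, 0 < (realQuot e h x).im := by
  filter_upwards [H.1] with x hx
  exact lt_of_le_of_ne (hn.realQuot_im_nonneg (right_ne_zero_of_realQuot_im_ne_zero hx)) hx.symm

namespace IsPencilFraction

variable {e h : Polynomial ℂ} {q p r : MvPolynomial (Fin 2) ℂ} {m : ℕ}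

theorem exists_eval_den_eq (H : IsPencilFraction e h q p r m) :
    ∃ a b : ℝ → ℂ, Continuous a ∧ Continuous b ∧
      ∀ (x : ℝ) (u : ℂ), MvPolynomial.eval ![beta x, u] p = a x + u * b x := by
  have hcont : ∀ u, Continuous fun x : ℝ => MvPolynomial.eval ![beta x, u] p := by
    intro u
    have h1 : Continuous fun x : ℝ => (beta x, u) := continuous_beta_ofReal.prodMk continuous_const
    have h2 := (continuous_eval_pair p).comp h1
    simpa only [Function.comp_def] using h2
  refine ⟨fun x => MvPolynomial.eval ![beta x, 0] p,
    fun x => MvPolynomial.eval ![beta x, 1] p - MvPolynomial.eval ![beta x, 0] p,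
    hcont 0, (hcont 1).sub (hcont 0), fun x u => ?_⟩
  rw [eval_eq_of_degreeOf_le_one H.degreeOf_den_le]

theorem hasRealLimit_of_eval_den_eq_zero (H : IsPencilFraction e h q p r m) {x₁ x₂ : ℝ}
    (hp : MvPolynomial.eval ![beta x₁, beta x₂] p = 0) : HasRealLimit e h x₁ x₂ := by
  have him : ∀ᶠ x in 𝓝[≠] x₁, (realQuot e h x).im ≠ 0 := by
    have hc := H.cross_ne_zero hp
    have hh : h ≠ 0 := by rintro rfl; simp [conjPoly] at hc
    filter_upwards [eventually_eval_ne_zero hc x₁, eventually_eval_ne_zero hh x₁] with x h1 h2 h3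
    apply h1
    have h4 : starRingEnd ℂ (h.eval (x : ℂ)) ≠ 0 := by simpa using h2
    have h5 := Complex.conj_eq_iff_im.2 h3
    rw [realQuot, map_div₀, div_eq_div_iff h4 h2] at h5
    rw [Polynomial.eval_sub, Polynomial.eval_mul, Polynomial.eval_mul, eval_conjPoly_ofReal,
      eval_conjPoly_ofReal]
    linear_combination -h5
  refine ⟨him, ?_⟩
  obtain ⟨a, b, hac, hbc, hev⟩ := H.exists_eval_den_eq
  have hab : a x₁ + beta x₂ * b x₁ = 0 := by rw [← hev, hp]
  -- If b vanished, p would be zero on the whole line. Since it does not, the unique zero -a/b of p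
  -- in z₂ depends continuously on x near x₁.
  have hb0 : b x₁ ≠ 0 := by
    intro h0
    obtain ⟨u, hu⟩ := H.exists_eval_den_ne_zero x₁
    rw [h0, mul_zero, add_zero] at hab
    exact hu (by rw [hev, hab, h0, mul_zero, add_zero])
  have hlim : Tendsto (fun x => -a x / b x) (𝓝[≠] x₁) (𝓝 (beta x₂)) := by
    have h1 : -a x₁ / b x₁ = beta x₂ := by
      rw [div_eq_iff hb0]
      linear_combination -hab
    rw [← h1]
    exact (ContinuousAt.div hac.neg.continuousAt hbc.continuousAt hb0).tendsto.mono_left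
      nhdsWithin_le_nhds
  have hbe : ∀ᶠ x in 𝓝[≠] x₁, b x ≠ 0 :=
    nhdsWithin_le_nhds (hbc.continuousAt.eventually_ne hb0)
  have heq : ∀ᶠ x in 𝓝[≠] x₁, starRingEnd ℂ (betaInv (-a x / b x)) = realQuot e h x := by
    filter_upwards [hbe, hlim.eventually_ne (beta_ofReal_ne_neg_one x₂), him] with x h1 h2 h3
    rw [(H.eval_den_eq_zero_iff h3 h2).1 (by rw [hev, div_mul_cancel₀ _ h1, add_neg_cancel]),
      Complex.conj_conj]
  have hlim' := Complex.continuous_conj.continuousAt.tendsto.comp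
    ((continuousAt_betaInv (beta_ofReal_ne_neg_one x₂)).tendsto.comp hlim)
  rw [betaInv_beta_ofReal, Complex.conj_ofReal] at hlim'
  exact hlim'.congr' heq

theorem eval_den_eq_zero_of_hasRealLimit (H : IsPencilFraction e h q p r m) {x₁ x₂ : ℝ}
    (hC : HasRealLimit e h x₁ x₂) : MvPolynomial.eval ![beta x₁, beta x₂] p = 0 := by
  have hconj : Tendsto (fun x => starRingEnd ℂ (realQuot e h x)) (𝓝[≠] x₁) (𝓝 (x₂ : ℂ)) := by
    simpa [Function.comp_def] using Complex.continuous_conj.continuousAt.tendsto.comp hC.2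
  have hu : Tendsto (fun x => beta (starRingEnd ℂ (realQuot e h x))) (𝓝[≠] x₁) (𝓝 (beta x₂)) :=
    (continuousAt_beta (one_sub_ofReal_mul_I_ne_zero x₂)).tendsto.comp hconj
  have hne : ∀ᶠ x in 𝓝[≠] x₁, 1 - starRingEnd ℂ (realQuot e h x) * Complex.I ≠ 0 := by
    have : Tendsto (fun x => 1 - starRingEnd ℂ (realQuot e h x) * Complex.I) (𝓝[≠] x₁)
      (𝓝 (1 - x₂ * Complex.I)) := tendsto_const_nhds.sub (hconj.mul_const _)
    exact this.eventually_ne (one_sub_ofReal_mul_I_ne_zero x₂)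
  have hz : ∀ᶠ x : ℝ in 𝓝[≠] x₁,
      MvPolynomial.eval ![beta x, beta (starRingEnd ℂ (realQuot e h x))] p = 0 := by
    filter_upwards [hne, hC.1] with x h1 h2
    exact (H.eval_den_eq_zero_iff h2 (beta_ne_neg_one h1)).2 (betaInv_beta h1)
  have hlim := ((continuous_eval_pair p).tendsto (beta x₁, beta x₂)).comp
    (((continuous_beta_ofReal.tendsto x₁).mono_left nhdsWithin_le_nhds).prodMk_nhds hu)
  exact tendsto_nhds_unique (hlim.congr' hz) tendsto_const_nhds

theorem eval_den_eq_zero_iff_hasRealLimit (H : IsPencilFraction e h q p r m) (x₁ x₂ : ℝ) :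
    MvPolynomial.eval ![beta x₁, beta x₂] p = 0 ↔ HasRealLimit e h x₁ x₂ :=
  ⟨H.hasRealLimit_of_eval_den_eq_zero, H.eval_den_eq_zero_of_hasRealLimit⟩

/-! ### Zeros of the reflection and the contact order -/

theorem eval_reflection_eq_zero_iff (H : IsPencilFraction e h q p r m) {x : ℝ}
    (hx : (realQuot e h x).im ≠ 0) {z : ℂ} (h0 : z ≠ 0) (h1 : z ≠ -1) :
    MvPolynomial.eval ![beta x, z] (reflection p) = 0 ↔ betaInv z = realQuot e h x := by
  have hb0 : beta x ≠ 0 := norm_ne_zero_iff.1 (by rw [norm_beta_ofReal]; exact one_ne_zero)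
  have hb : 1 / starRingEnd ℂ (beta x) = beta x := by
    rw [div_eq_iff (by simpa using hb0), Complex.mul_conj, Complex.normSq_eq_norm_sq,
      norm_beta_ofReal]
    simp
  have h1' : 1 / starRingEnd ℂ z ≠ -1 := by
    intro hz
    rw [div_eq_iff (by simpa using h0)] at hz
    have h2 : starRingEnd ℂ z = -1 := by linear_combination hz
    apply h1
    simpa using congrArg (starRingEnd ℂ) h2
  rw [eval_reflection _ _ _ hb0 h0, hb, mul_eq_zero,
    or_iff_right (mul_ne_zero (pow_ne_zero _ hb0) (pow_ne_zero _ h0)), map_eq_zero,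
    H.eval_den_eq_zero_iff hx h1', betaInv_one_div_conj h0 h1,
    (starRingEnd ℂ).injective.eq_iff]

theorem setOf_reflection_zeros (H : IsPencilFraction e h q p r m) {x x₂ δ : ℝ}
    (hx : 0 < (realQuot e h x).im) (hδ₁ : δ ≤ 1) (hδ₂ : δ ≤ ‖beta x₂ + 1‖)
    (hxδ : ‖beta x₂ - beta (realQuot e h x)‖ < δ) :
    {d : ℝ | ∃ z₂ : ℂ, ‖z₂‖ < 1 ∧ ‖beta x₂ - z₂‖ < δ ∧
      MvPolynomial.eval ![beta x, z₂] (reflection p) = 0 ∧ d = 1 - ‖z₂‖} =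
        {1 - ‖beta (realQuot e h x)‖} := by
  have hW : 1 - realQuot e h x * Complex.I ≠ 0 := one_sub_mul_I_ne_zero (by linarith)
  -- The bounds on δ keep the disk around β(x₂) away from 0, where the reflection formula fails, and
  -- from -1, the pole of β⁻¹.
  have hz : ∀ z : ℂ, ‖beta x₂ - z‖ < δ → z ≠ 0 ∧ z ≠ -1 := by
    intro z hz
    constructor
    · rintro rfl
      rw [sub_zero, norm_beta_ofReal] at hz
      linarith
    · rintro rfl
      rw [sub_neg_eq_add] at hz
      linarith
  ext d
  constructor
  · rintro ⟨z, -, h2, h3, rfl⟩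
    obtain ⟨h0, h1⟩ := hz z h2
    rw [← (H.eval_reflection_eq_zero_iff hx.ne' h0 h1).1 h3, beta_betaInv h1]
    rfl
  · rintro rfl
    obtain ⟨h0, h1⟩ := hz _ hxδ
    refine ⟨_, ?_, hxδ, (H.eval_reflection_eq_zero_iff hx.ne' h0 h1).2 (betaInv_beta hW), rfl⟩
    have h2 := one_sub_normSq_beta hW
    have h3 : 0 < 4 * (realQuot e h x).im / ‖1 - realQuot e h x * Complex.I‖ ^ 2 := by
      have := norm_pos_iff.2 hW
      positivity
    nlinarith [norm_nonneg (beta (realQuot e h x))]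

end IsPencilFraction

/-- 1 - |β(w)| = 4 Im w / (|1 - iw|² (1 + |β(w)|)), and the factor multiplying Im w has a positive
limit at the real point x₂. -/
theorem HasRealLimit.one_sub_norm_beta_isTheta {e h : Polynomial ℂ} {x₁ x₂ : ℝ}
    (H : HasRealLimit e h x₁ x₂) :
    (fun x => 1 - ‖beta (realQuot e h x)‖) =Θ[𝓝[≠] x₁] fun x => (realQuot e h x).im := by
  have hne := one_sub_ofReal_mul_I_ne_zero x₂
  have hlim : Tendsto (fun x => 1 - realQuot e h x * Complex.I) (𝓝[≠] x₁)
      (𝓝 (1 - x₂ * Complex.I)) := tendsto_const_nhds.sub (H.2.mul_const _)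
  have hpos : 0 < ‖1 - (x₂ : ℂ) * Complex.I‖ ^ 2 * (1 + ‖beta x₂‖) := by
    have := norm_pos_iff.2 hne
    positivity
  have h1 : Tendsto (fun x => 4 / (‖1 - realQuot e h x * Complex.I‖ ^ 2 *
      (1 + ‖beta (realQuot e h x)‖))) (𝓝[≠] x₁)
      (𝓝 (4 / (‖1 - (x₂ : ℂ) * Complex.I‖ ^ 2 * (1 + ‖beta x₂‖)))) :=
    tendsto_const_nhds.div ((hlim.norm.pow 2).mul (tendsto_const_nhds.add H.tendsto_beta.norm))
      hpos.ne'
  have h2 := (isTheta_one_of_tendsto h1 (div_pos (by norm_num) hpos).ne').mul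
    (isTheta_refl (fun x => (realQuot e h x).im) (𝓝[≠] x₁))
  simp only [one_mul] at h2
  refine IsTheta.trans (EventuallyEq.isTheta ?_) h2
  filter_upwards [hlim.eventually_ne hne] with x hx
  have h3 := one_sub_normSq_beta hx
  have h4 : 1 + ‖beta (realQuot e h x)‖ ≠ 0 := by positivity
  have h5 : ‖1 - realQuot e h x * Complex.I‖ ^ 2 ≠ 0 := by simpa using hx
  rw [eq_div_iff h5] at h3
  rw [div_mul_eq_mul_div, eq_div_iff (mul_ne_zero h5 h4)]
  linear_combination h3

theorem IsPencilFraction.hasContactOrder_iff {e h : Polynomial ℂ}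
    {q p r : MvPolynomial (Fin 2) ℂ} {m : ℕ} (H : IsPencilFraction e h q p r m) {x₁ x₂ : ℝ}
    (hC : HasRealLimit e h x₁ x₂) (k : ℕ) :
    HasContactOrder p (beta x₁) (beta x₂) k ↔
      (fun x => (realQuot e h x).im) =Θ[𝓝[≠] x₁] fun x => |x - x₁| ^ k := by
  have hpow : (fun x : ℝ => ‖beta x₁ - beta x‖ ^ k) =Θ[𝓝[≠] x₁] fun x => |x - x₁| ^ k :=
    (norm_beta_sub_beta_isTheta x₁).pow k
  have hδ : ∀ᶠ δ : ℝ in 𝓝[>] 0, ((fun z₁ : ℂ => sInf {d : ℝ | ∃ z₂ : ℂ, ‖z₂‖ < 1 ∧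
      ‖beta x₂ - z₂‖ < δ ∧ MvPolynomial.eval ![z₁, z₂] (reflection p) = 0 ∧ d = 1 - ‖z₂‖})
        =Θ[𝓝[{z : ℂ | ‖z‖ = 1 ∧ z ≠ beta x₁}] (beta x₁)] (fun z₁ : ℂ => ‖beta x₁ - z₁‖ ^ k) ↔
      (fun x => (realQuot e h x).im) =Θ[𝓝[≠] x₁] fun x => |x - x₁| ^ k) := by
    have hpos : 0 < min 1 ‖beta x₂ + 1‖ := by
      refine lt_min one_pos (norm_pos_iff.2 ?_)
      rw [add_comm]
      exact one_add_ne_zero (beta_ofReal_ne_neg_one x₂)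
    filter_upwards [Ioo_mem_nhdsGT hpos] with δ hδ
    rw [← map_beta_nhdsNE, IsTheta, isBigO_map, isBigO_map]
    have hev : (fun z₁ : ℂ => sInf {d : ℝ | ∃ z₂ : ℂ, ‖z₂‖ < 1 ∧ ‖beta x₂ - z₂‖ < δ ∧
        MvPolynomial.eval ![z₁, z₂] (reflection p) = 0 ∧ d = 1 - ‖z₂‖}) ∘ (fun x : ℝ => beta x)
        =ᶠ[𝓝[≠] x₁] fun x => 1 - ‖beta (realQuot e h x)‖ := by
      have hclose : ∀ᶠ x in 𝓝[≠] x₁, ‖beta x₂ - beta (realQuot e h x)‖ < δ := by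
        have := (tendsto_const_nhds (x := beta x₂)).sub hC.tendsto_beta
        rw [sub_self] at this
        simpa using this.norm.eventually_lt_const (by simpa using hδ.1)
      filter_upwards [hC.eventually_im_pos H.nonvanishing, hclose] with x h1 h2
      rw [Function.comp_apply, H.setOf_reflection_zeros h1 (hδ.2.le.trans (min_le_left _ _))
        (hδ.2.le.trans (min_le_right _ _)) h2, csInf_singleton]
    have hT := hev.isTheta.trans hC.one_sub_norm_beta_isTheta
    exact ⟨fun hh => hT.symm.trans (IsTheta.trans hh hpow),
      fun hh => (hT.trans hh).trans hpow.symm⟩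
  constructor
  · rintro ⟨-, hh⟩
    -- The right-hand side does not involve δ, so one admissible δ suffices.
    obtain ⟨δ, h1, h2⟩ := (hh.and hδ).exists
    exact h2.1 h1
  · intro hh
    exact ⟨H.eval_den_eq_zero_of_hasRealLimit hC, hδ.mono fun δ h1 => h1.2 hh⟩

/-! ### Existence and uniqueness of the order of vanishing -/

theorem le_of_abs_sub_pow_isBigO {x₁ : ℝ} {a b : ℕ}
    (h : (fun x : ℝ => |x - x₁| ^ a) =O[𝓝[≠] x₁] fun x => |x - x₁| ^ b) : b ≤ a := by
  by_contra! hlt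
  have hlim : Tendsto (fun x : ℝ => |x - x₁|) (𝓝[≠] x₁) (𝓝 0) := by
    have : Continuous fun x : ℝ => |x - x₁| := by fun_prop
    simpa using (this.tendsto x₁).mono_left nhdsWithin_le_nhds
  have h1 : (fun x : ℝ => |x - x₁| ^ b) =o[𝓝[≠] x₁] fun x => |x - x₁| ^ a :=
    (isLittleO_pow_pow (𝕜 := ℝ) hlt).comp_tendsto hlim
  refine isLittleO_irrefl (Eventually.frequently ?_) (h.trans_isLittleO h1)
  filter_upwards [self_mem_nhdsWithin] with x hx
  exact pow_ne_zero _ (abs_ne_zero.2 (sub_ne_zero.2 hx))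

theorem exists_eval_isTheta {p : Polynomial ℂ} (hp : p ≠ 0) (x₁ : ℝ) :
    ∃ a : ℕ, (fun x : ℝ => p.eval (x : ℂ)) =Θ[𝓝[≠] x₁] fun x => |x - x₁| ^ a := by
  obtain ⟨q, hq, hdvd⟩ :=
    Polynomial.exists_eq_pow_rootMultiplicity_mul_and_not_dvd p hp (x₁ : ℂ)
  set a := p.rootMultiplicity (x₁ : ℂ)
  have hq1 : q.eval (x₁ : ℂ) ≠ 0 := fun h0 => hdvd (Polynomial.dvd_iff_isRoot.2 h0)
  refine ⟨a, isTheta_norm_left.1 ?_⟩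
  have h1 : ∀ x : ℝ, ‖p.eval (x : ℂ)‖ = |x - x₁| ^ a * ‖q.eval (x : ℂ)‖ := by
    intro x
    have : p.eval (x : ℂ) = ((x - x₁ : ℝ) : ℂ) ^ a * q.eval (x : ℂ) := by
      rw [hq]
      simp
    rw [this, norm_mul, norm_pow, Complex.norm_real, Real.norm_eq_abs]
  have h2 : Tendsto (fun x : ℝ => ‖q.eval (x : ℂ)‖) (𝓝[≠] x₁) (𝓝 ‖q.eval (x₁ : ℂ)‖) := by
    have : Continuous fun x : ℝ => ‖q.eval (x : ℂ)‖ :=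
      (q.continuous.comp Complex.continuous_ofReal).norm
    exact (this.tendsto x₁).mono_left nhdsWithin_le_nhds
  simp_rw [h1]
  simpa using (isTheta_refl (fun x : ℝ => |x - x₁| ^ a) (𝓝[≠] x₁)).mul
    (isTheta_one_of_tendsto h2 (norm_ne_zero_iff.2 hq1))

/-- With h̄ and ē the conjugate polynomials, 2i h h̄ Im R = e h̄ - ē h on the real line, so K is a
difference of two root multiplicities. -/
theorem HasRealLimit.exists_im_isTheta {e h : Polynomial ℂ} {x₁ x₂ : ℝ}
    (H : HasRealLimit e h x₁ x₂) :
    ∃ K : ℕ, (fun x => (realQuot e h x).im) =Θ[𝓝[≠] x₁] fun x => |x - x₁| ^ K := by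
  have hmul : ∀ᶠ x : ℝ in 𝓝[≠] x₁, ((realQuot e h x).im : ℂ) *
      (Polynomial.C (2 * Complex.I) * h * conjPoly h).eval (x : ℂ) =
        (e * conjPoly h - conjPoly e * h).eval (x : ℂ) := by
    filter_upwards [H.1] with x hx
    have h1 := right_ne_zero_of_realQuot_im_ne_zero hx
    have h2 : starRingEnd ℂ (h.eval (x : ℂ)) ≠ 0 := by simpa using h1
    have h3 : ((realQuot e h x).im : ℂ) * (2 * Complex.I) =
        realQuot e h x - starRingEnd ℂ (realQuot e h x) := by
      rw [Complex.sub_conj]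
      push_cast
      ring
    simp only [Polynomial.eval_mul, Polynomial.eval_sub, Polynomial.eval_C, eval_conjPoly_ofReal]
    rw [← mul_assoc, ← mul_assoc, h3, realQuot, map_div₀]
    field_simp
  have him : ∀ᶠ x : ℝ in 𝓝[≠] x₁, (Polynomial.C (2 * Complex.I) * h * conjPoly h).eval (x : ℂ) ≠ 0 ∧
      (e * conjPoly h - conjPoly e * h).eval (x : ℂ) ≠ 0 := by
    filter_upwards [hmul, H.1] with x h1 h2
    have h3 := right_ne_zero_of_realQuot_im_ne_zero h2
    have h4 : (Polynomial.C (2 * Complex.I) * h * conjPoly h).eval (x : ℂ) ≠ 0 := by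
      simp [eval_conjPoly_ofReal, h3]
    exact ⟨h4, h1 ▸ mul_ne_zero (by simpa using h2) h4⟩
  obtain ⟨x₀, hd₀, hn₀⟩ := him.exists
  obtain ⟨a, ha⟩ := exists_eval_isTheta (p := e * conjPoly h - conjPoly e * h)
    (fun h0 => hn₀ (by rw [h0, Polynomial.eval_zero])) x₁
  obtain ⟨b, hb⟩ := exists_eval_isTheta (p := Polynomial.C (2 * Complex.I) * h * conjPoly h)
    (fun h0 => hd₀ (by rw [h0, Polynomial.eval_zero])) x₁
  have hlim : Tendsto (fun x => ((realQuot e h x).im : ℂ)) (𝓝[≠] x₁) (𝓝 0) := by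
    have := (Complex.continuous_ofReal.comp Complex.continuous_im).continuousAt.tendsto.comp H.2
    simpa [Function.comp_def] using this
  -- Im R tends to 0 and is therefore bounded, so the exponent a - b is a genuine natural number.
  have hab : b ≤ a := by
    refine le_of_abs_sub_pow_isBigO (x₁ := x₁) ?_
    have h1 := ((hlim.isBigO_one ℝ).mul hb.1).congr' hmul EventuallyEq.rfl
    simp only [one_mul] at h1
    exact ha.2.trans h1
  refine ⟨a - b, ?_⟩
  have h1 : (fun x => ((realQuot e h x).im : ℂ)) =Θ[𝓝[≠] x₁]
      fun x => |x - x₁| ^ a / |x - x₁| ^ b := by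
    refine IsTheta.trans (EventuallyEq.isTheta ?_) (ha.div hb)
    filter_upwards [hmul, him] with x h1 h2
    rw [eq_div_iff h2.1, h1]
  have h2 : (fun x => |x - x₁| ^ a / |x - x₁| ^ b) =ᶠ[𝓝[≠] x₁] fun x => |x - x₁| ^ (a - b) := by
    filter_upwards [self_mem_nhdsWithin] with x hx
    rw [pow_sub₀ _ (abs_ne_zero.2 (sub_ne_zero.2 hx)) hab, div_eq_mul_inv]
  have h3 := isTheta_norm_left.2 (h1.trans h2.isTheta)
  simp only [Complex.norm_real] at h3
  exact isTheta_norm_left.1 h3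

theorem isTheta_abs_sub_pow_iff {x₁ : ℝ} {f : ℝ → ℝ} {K : ℕ}
    (hf : f =Θ[𝓝[≠] x₁] fun x => |x - x₁| ^ K) (k : ℕ) :
    (f =Θ[𝓝[≠] x₁] fun x => |x - x₁| ^ k) ↔ k = K := by
  constructor
  · intro hk
    have h1 := hk.symm.trans hf
    exact le_antisymm (le_of_abs_sub_pow_isBigO h1.2) (le_of_abs_sub_pow_isBigO h1.1)
  · rintro rfl
    exact hf

/-! ### The shift of w₂ to t w₁ + (1 - t) w₂ -/

/-- The first coefficient of the pencil obtained from `e - w₂ h` by replacing `w₂` with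
`t w₁ + (1 - t) w₂`. -/
def shiftLeft (t : ℝ) (e h : Polynomial ℂ) : Polynomial ℂ :=
  e - Polynomial.C (t : ℂ) * Polynomial.X * h

/-- The second coefficient of the pencil obtained from `e - w₂ h` by replacing `w₂` with
`t w₁ + (1 - t) w₂`. -/
def shiftRight (t : ℝ) (h : Polynomial ℂ) : Polynomial ℂ := Polynomial.C ((1 - t : ℝ) : ℂ) * h

theorem eval_shift (t : ℝ) (e h : Polynomial ℂ) (w₁ w₂ : ℂ) :
    (shiftLeft t e h).eval w₁ - w₂ * (shiftRight t h).eval w₁ =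
      e.eval w₁ - (t * w₁ + (1 - t) * w₂) * h.eval w₁ := by
  simp [shiftLeft, shiftRight]
  ring

theorem conjPoly_shiftLeft (t : ℝ) (e h : Polynomial ℂ) :
    conjPoly (shiftLeft t e h) = shiftLeft t (conjPoly e) (conjPoly h) := by
  simp [conjPoly, shiftLeft]

theorem conjPoly_shiftRight (t : ℝ) (h : Polynomial ℂ) :
    conjPoly (shiftRight t h) = shiftRight t (conjPoly h) := by
  simp [conjPoly, shiftRight]

theorem LowerNonvanishing.shift {e h : Polynomial ℂ} (H : LowerNonvanishing e h) {t : ℝ}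
    (ht₀ : 0 ≤ t) (ht₁ : t < 1) : LowerNonvanishing (shiftLeft t e h) (shiftRight t h) := by
  intro w₁ w₂ h₁ h₂
  rw [eval_shift]
  refine H _ _ h₁ ?_
  simp
  nlinarith

theorem realQuot_shift {t : ℝ} (ht₁ : t < 1) {e h : Polynomial ℂ} {x : ℝ}
    (hx : h.eval (x : ℂ) ≠ 0) : realQuot (shiftLeft t e h) (shiftRight t h) x =
      (realQuot e h x - t * x) / ((1 - t : ℝ) : ℂ) := by
  have ht : ((1 - t : ℝ) : ℂ) ≠ 0 := by
    exact_mod_cast (sub_pos.2 ht₁).ne'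
  simp only [realQuot, shiftLeft, shiftRight, Polynomial.eval_sub, Polynomial.eval_mul,
    Polynomial.eval_C, Polynomial.eval_X]
  field_simp

theorem realQuot_shift_im {t : ℝ} (ht₁ : t < 1) (e h : Polynomial ℂ) (x : ℝ) :
    (realQuot (shiftLeft t e h) (shiftRight t h) x).im = (realQuot e h x).im / (1 - t) := by
  by_cases hx : h.eval (x : ℂ) = 0
  -- At a zero of h both quotients are 0 by the convention for division by zero.
  · simp [realQuot, shiftRight, hx]
  · rw [realQuot_shift ht₁ hx, Complex.div_ofReal_im]
    simp

theorem hasRealLimit_shift_iff {t : ℝ} (ht₁ : t < 1) (e h : Polynomial ℂ) (x₁ x₂ : ℝ) :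
    HasRealLimit (shiftLeft t e h) (shiftRight t h) x₁ ((x₂ - t * x₁) / (1 - t)) ↔
      HasRealLimit e h x₁ x₂ := by
  have ht : 1 - t ≠ 0 := (sub_pos.2 ht₁).ne'
  have htc : ((1 - t : ℝ) : ℂ) ≠ 0 := by exact_mod_cast ht
  have hx : Tendsto (fun x : ℝ => (t : ℂ) * x) (𝓝[≠] x₁) (𝓝 (t * x₁)) := by
    have : Continuous fun x : ℝ => (t : ℂ) * x := by fun_prop
    exact (this.tendsto x₁).mono_left nhdsWithin_le_nhds
  unfold HasRealLimit
  simp only [realQuot_shift_im ht₁, ne_eq, div_eq_zero_iff, ht, or_false]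
  refine and_congr_right fun him => ?_
  have hev : realQuot (shiftLeft t e h) (shiftRight t h) =ᶠ[𝓝[≠] x₁]
      fun x => (realQuot e h x - t * x) / ((1 - t : ℝ) : ℂ) := by
    filter_upwards [him] with x hx
    exact realQuot_shift ht₁ (right_ne_zero_of_realQuot_im_ne_zero hx)
  rw [tendsto_congr' hev]
  constructor
  · intro hlim
    have h1 := (hlim.mul_const ((1 - t : ℝ) : ℂ)).add hx
    have h2 : (((x₂ - t * x₁) / (1 - t) : ℝ) : ℂ) * ((1 - t : ℝ) : ℂ) + t * x₁ = x₂ := by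
      rw [Complex.ofReal_div, div_mul_cancel₀ _ htc]
      push_cast
      ring
    rw [h2] at h1
    refine h1.congr fun x => ?_
    rw [div_mul_cancel₀ _ htc, sub_add_cancel]
  · intro hlim
    have := (hlim.sub hx).div_const ((1 - t : ℝ) : ℂ)
    push_cast at this ⊢
    exact this

/-! ### Determinants of perturbed Hermitian matrices -/

theorem det_add_smul_single {n R : Type*} [Fintype n] [DecidableEq n] [CommRing R]
    (M : Matrix n n R) (i : n) (s : R) :
    (M + s • Matrix.single i i 1).det = M.det + s * M.adjugate i i := by
  have h : M + s • Matrix.single i i 1 = M.updateRow i (M i + s • Pi.single i 1) := by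
    ext j k
    by_cases hj : j = i
    · subst hj
      by_cases hk : k = j
      · subst hk; simp
      · simp [hk, Ne.symm hk]
    · simp [hj, Ne.symm hj]
  rw [h, Matrix.det_updateRow_add, Matrix.updateRow_eq_self, Matrix.det_updateRow_smul,
    Matrix.adjugate_apply]

/-- For v in the kernel, the imaginary part of v*(A + D)v is ∑ Im(dᵢ)|vᵢ|², since v*Av is real; this
forces v = 0. -/
theorem det_add_diagonal_ne_zero {n : Type*} [Fintype n] [DecidableEq n] {A : Matrix n n ℂ}
    (hA : A.IsHermitian) {d : n → ℂ} (hd : ∀ i, 0 < (d i).im) :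
    (A + Matrix.diagonal d).det ≠ 0 := by
  intro h0
  obtain ⟨v, hv, hv0⟩ := Matrix.exists_mulVec_eq_zero_iff.2 h0
  have h1 : (star v ⬝ᵥ (A.mulVec v)).im = 0 := hA.im_star_dotProduct_mulVec_self v
  have h2 := congrArg (fun u => (star v ⬝ᵥ u).im) hv0
  simp only [Matrix.add_mulVec, dotProduct_add, Complex.add_im, h1, zero_add, dotProduct_zero,
    Complex.zero_im] at h2
  have h3 : (star v ⬝ᵥ (Matrix.diagonal d).mulVec v).im = ∑ i, (d i).im * Complex.normSq (v i) := by
    rw [dotProduct, Complex.im_sum]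
    refine Finset.sum_congr rfl fun i _ => ?_
    rw [Matrix.mulVec_diagonal, Pi.star_apply, Complex.normSq_apply]
    simp
    ring
  rw [h3] at h2
  have h4 := (Finset.sum_eq_zero_iff_of_nonneg fun i _ =>
    mul_nonneg (hd i).le (Complex.normSq_nonneg _)).1 h2
  apply hv
  funext i
  have := h4 i (Finset.mem_univ i)
  simpa [(hd i).ne'] using this

/-! ### The pencil of a colored graph -/

variable {n : ℕ} (G : SimpleGraph (Fin (n + 1))) [DecidableRel G.Adj]

/-- The matrix `A - w₁ Y - w₂ (I - Y)` for `t = 0`, the coloring that singles out the last vertex. -/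
def colorPencil (w₁ w₂ : ℂ) : Matrix (Fin (n + 1)) (Fin (n + 1)) ℂ :=
  G.adjMatrix ℂ - w₁ • coloring n 0 - w₂ • (1 - coloring n 0)

theorem one_sub_coloring_zero :
    1 - coloring n 0 = Matrix.single (Fin.last n) (Fin.last n) (1 : ℂ) := by
  rw [coloring, ← Matrix.diagonal_one, Matrix.diagonal_sub, ← Matrix.diagonal_single]
  congr 1
  funext i
  by_cases hi : i = Fin.last n
  · subst hi; simp
  · simp [hi]

theorem coloring_eq (t : ℝ) :
    coloring n t = coloring n 0 + (t : ℂ) • (1 - coloring n 0) := by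
  rw [coloring, coloring, ← Matrix.diagonal_one, Matrix.diagonal_sub, ← Matrix.diagonal_smul,
    Matrix.diagonal_add]
  congr 1
  funext i
  by_cases hi : i = Fin.last n <;> simp [hi]

theorem colorPencil_eq_add_diagonal (w₁ w₂ : ℂ) :
    colorPencil G w₁ w₂ =
      G.adjMatrix ℂ + Matrix.diagonal fun i => if i = Fin.last n then -w₂ else -w₁ := by
  rw [colorPencil, coloring, ← Matrix.diagonal_one, Matrix.diagonal_sub, ← Matrix.diagonal_smul,
    ← Matrix.diagonal_smul, sub_sub, Matrix.diagonal_add, sub_eq_add_neg, Matrix.diagonal_neg]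
  congr 2
  funext i
  by_cases hi : i = Fin.last n <;> simp [hi]

theorem fA_eq_fA_zero (t : ℝ) (w₁ w₂ : ℂ) :
    fA G t w₁ w₂ = (colorPencil G w₁ (t * w₁ + (1 - t) * w₂))⁻¹ 0 0 := by
  have h : G.adjMatrix ℂ - w₁ • coloring n t - w₂ • (1 - coloring n t) =
      colorPencil G w₁ (t * w₁ + (1 - t) * w₂) := by
    rw [colorPencil, coloring_eq t]
    generalize (1 : Matrix (Fin (n + 1)) (Fin (n + 1)) ℂ) = E
    module
  rw [fA, h]

theorem isHermitian_adjMatrix : (G.adjMatrix ℂ).IsHermitian := by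
  ext i j
  simp [Matrix.conjTranspose_apply, SimpleGraph.adjMatrix_apply, G.adj_comm]

theorem det_colorPencil_ne_zero {w₁ w₂ : ℂ} (h₁ : 0 < w₁.im) (h₂ : 0 < w₂.im) :
    (colorPencil G w₁ w₂).det ≠ 0 := by
  have h := det_add_diagonal_ne_zero (isHermitian_adjMatrix G).neg
    (d := fun i => if i = Fin.last n then w₂ else w₁) (fun i => by split_ifs <;> assumption)
  have h1 : -G.adjMatrix ℂ + Matrix.diagonal (fun i => if i = Fin.last n then w₂ else w₁) =
      -colorPencil G w₁ w₂ := by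
    rw [colorPencil_eq_add_diagonal, neg_add, Matrix.diagonal_neg]
    congr 2
    funext i
    by_cases hi : i = Fin.last n <;> simp [hi]
  rw [h1, Matrix.det_neg] at h
  exact right_ne_zero_of_mul h

/-- The determinant `det (A + i E₁₁ - w₁ Y - w₂ (I - Y))` for `t = 0`. -/
def cornerDet (w₁ w₂ : ℂ) : ℂ :=
  (colorPencil G w₁ w₂ + Complex.I • Matrix.single 0 0 1).det

/-- The diagonal entries -w₁, -w₂ lie in the upper half-plane, and adding i in the corner only
raises an imaginary part. -/
theorem cornerDet_ne_zero {w₁ w₂ : ℂ} (h₁ : w₁.im < 0) (h₂ : w₂.im < 0) :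
    cornerDet G w₁ w₂ ≠ 0 := by
  have h := det_add_diagonal_ne_zero (isHermitian_adjMatrix G)
    (d := fun i => (if i = Fin.last n then -w₂ else -w₁) + Complex.I * (if i = 0 then 1 else 0))
    (fun i => by
      rw [Complex.add_im]
      have h3 : 0 < (if i = Fin.last n then -w₂ else -w₁).im := by split_ifs <;> simpa
      have h4 : 0 ≤ (Complex.I * (if i = 0 then 1 else 0)).im := by split_ifs <;> simp
      linarith)
  convert h using 1
  rw [cornerDet, colorPencil_eq_add_diagonal, add_assoc, ← Matrix.diagonal_single, ← Matrix.diagonal_smul,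
    Matrix.diagonal_add]
  congr 3
  funext i
  by_cases hi : i = 0
  · subst hi; simp
  · simp [hi]

/-- The part of the matrix defining `cornerDet` that does not involve `w₂`, over `ℂ[w₁]`. -/
def cornerMatrix : Matrix (Fin (n + 1)) (Fin (n + 1)) (Polynomial ℂ) :=
  (G.adjMatrix ℂ + Complex.I • Matrix.single 0 0 1).map Polynomial.C -
    (coloring n 0).map fun c => Polynomial.X * Polynomial.C c

theorem map_eval_cornerMatrix (w : ℂ) : (Polynomial.evalRingHom w).mapMatrix (cornerMatrix G) =
    G.adjMatrix ℂ + Complex.I • Matrix.single 0 0 1 - w • coloring n 0 := by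
  ext i j
  simp [cornerMatrix, SimpleGraph.adjMatrix_apply, apply_ite (Polynomial.eval w), mul_comm w]

/-- For t = 0, w₂ occurs only in the last diagonal entry, so the determinant is affine in w₂ with
the corresponding cofactor as slope. -/
theorem cornerDet_eq (w₁ w₂ : ℂ) : cornerDet G w₁ w₂ = (cornerMatrix G).det.eval w₁ -
    w₂ * ((cornerMatrix G).adjugate (Fin.last n) (Fin.last n)).eval w₁ := by
  have h1 : (cornerMatrix G).det.eval w₁ =
      ((Polynomial.evalRingHom w₁).mapMatrix (cornerMatrix G)).det := by
    rw [← RingHom.map_det, Polynomial.coe_evalRingHom]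
  have h2 : ((cornerMatrix G).adjugate (Fin.last n) (Fin.last n)).eval w₁ =
      ((Polynomial.evalRingHom w₁).mapMatrix (cornerMatrix G)).adjugate (Fin.last n)
        (Fin.last n) := by
    rw [← RingHom.map_adjugate, RingHom.mapMatrix_apply, Matrix.map_apply,
      Polynomial.coe_evalRingHom]
  rw [h1, h2, sub_eq_add_neg, ← neg_mul, ← det_add_smul_single, map_eval_cornerMatrix,
    ← one_sub_coloring_zero, cornerDet, colorPencil]
  congr 1
  module

theorem lowerNonvanishing_cornerMatrix : LowerNonvanishing (cornerMatrix G).det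
    ((cornerMatrix G).adjugate (Fin.last n) (Fin.last n)) := fun w₁ w₂ h₁ h₂ => by
  rw [← cornerDet_eq]
  exact cornerDet_ne_zero G h₁ h₂

theorem conj_cornerDet (w₁ w₂ : ℂ) :
    starRingEnd ℂ (cornerDet G (starRingEnd ℂ w₁) (starRingEnd ℂ w₂)) =
      (colorPencil G w₁ w₂ + (-Complex.I) • Matrix.single 0 0 1).det := by
  rw [cornerDet, RingHom.map_det]
  congr 1
  ext i j
  simp only [RingHom.mapMatrix_apply, Matrix.map_apply, colorPencil_eq_add_diagonal,
    Matrix.add_apply, Matrix.smul_apply, map_add, smul_eq_mul, map_mul, Complex.conj_I]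
  congr 1
  · congr 1
    · simp [SimpleGraph.adjMatrix_apply, apply_ite (starRingEnd ℂ)]
    · by_cases hij : i = j
      · subst hij; by_cases hi : i = Fin.last n <;> simp [hi]
      · simp [hij]
  · rw [Matrix.single_apply]
    split_ifs <;> simp

/-- By Cramer's rule the entry is N/D, and β(N/D) = (D + iN)/(D - iN). Both parts are rank-one
perturbations of D, conjugate to each other because the adjacency matrix is real. -/
theorem beta_inv_colorPencil_mul {w₁ w₂ : ℂ} (h₁ : 0 < w₁.im) (h₂ : 0 < w₂.im) :
    beta ((colorPencil G w₁ w₂)⁻¹ 0 0) *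
      starRingEnd ℂ (cornerDet G (starRingEnd ℂ w₁) (starRingEnd ℂ w₂)) = cornerDet G w₁ w₂ := by
  have hD := det_colorPencil_ne_zero G h₁ h₂
  have hF : starRingEnd ℂ (cornerDet G (starRingEnd ℂ w₁) (starRingEnd ℂ w₂)) ≠ 0 :=
    (map_ne_zero _).2 (cornerDet_ne_zero G (by simpa) (by simpa))
  rw [conj_cornerDet, det_add_smul_single] at hF ⊢
  rw [cornerDet, det_add_smul_single, Matrix.inv_def, Matrix.smul_apply, smul_eq_mul,
    Ring.inverse_eq_inv']
  set D := (colorPencil G w₁ w₂).det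
  set N := (colorPencil G w₁ w₂).adjugate 0 0
  have h3 : 1 - D⁻¹ * N * Complex.I = (D + -Complex.I * N) / D := by field_simp; ring
  have h4 : 1 + D⁻¹ * N * Complex.I = (D + Complex.I * N) / D := by field_simp
  rw [beta, h3, h4, div_div_div_cancel_right₀ hD, div_mul_cancel₀ _ hF]

/-- The reduced denominators of `φ_A^t` come from cancellation in the shifted pencil. -/
theorem exists_isPencilFraction_phiA {t : ℝ} (ht₀ : 0 ≤ t) (ht₁ : t < 1)
    {q p : MvPolynomial (Fin 2) ℂ} (hqp : IsReducedFraction (phiA G t) q p) :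
    ∃ r m, IsPencilFraction
      (shiftLeft t (cornerMatrix G).det ((cornerMatrix G).adjugate (Fin.last n) (Fin.last n)))
      (shiftRight t ((cornerMatrix G).adjugate (Fin.last n) (Fin.last n))) q p r m := by
  refine hqp.exists_isPencilFraction ((lowerNonvanishing_cornerMatrix G).shift ht₀ ht₁)
    fun z₁ z₂ hz₁ hz₂ => ?_
  have h₁ := betaInv_im_pos hz₁
  have h₂ := betaInv_im_pos hz₂
  set w₁ := betaInv z₁ with hw₁
  set w₂ := betaInv z₂ with hw₂
  have h₃ : 0 < (t * w₁ + (1 - t) * w₂).im := by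
    simp
    nlinarith
  have key := beta_inv_colorPencil_mul G h₁ h₃
  rw [conjPoly_shiftLeft, conjPoly_shiftRight, eval_shift, eval_shift, ← cornerDet_eq, phiA,
    fA_eq_fA_zero, ← hw₁, ← hw₂, ← key]
  congr 1
  rw [cornerDet_eq, map_sub, map_mul, ← eval_conjPoly_conj, ← eval_conjPoly_conj,
    Complex.conj_conj, Complex.conj_conj]

end GraphStable

end

open GraphStable
theorem mainTheorem6 {n : ℕ} (G : SimpleGraph (Fin (n + 1))) [DecidableRel G.Adj]
    (t : ℝ) (ht₀ : 0 ≤ t) (ht₁ : t < 1)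
    (qA pA qAt pAt : MvPolynomial (Fin 2) ℂ)
    (hA : IsReducedFraction (phiA G 0) qA pA)
    (hAt : IsReducedFraction (phiA G t) qAt pAt)
    (τ₁ τ₂ : ℂ) (hτ₁ : ‖τ₁‖ = 1) (hτ₂ : ‖τ₂‖ = 1) (hτ₁' : τ₁ ≠ -1) (hτ₂' : τ₂ ≠ -1)
    (l₁ l₂ : ℂ) (hl₁ : l₁ = τ₁)
    (hl₂ : l₂ = beta ((betaInv τ₂ - t * betaInv τ₁) / (1 - t))) :
    (MvPolynomial.eval ![τ₁, τ₂] pA = 0 ↔ MvPolynomial.eval ![l₁, l₂] pAt = 0) ∧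
    (MvPolynomial.eval ![τ₁, τ₂] pA = 0 →
      ∃ K : ℕ, (∀ k : ℕ, HasContactOrder pA τ₁ τ₂ k ↔ k = K) ∧
        (∀ k : ℕ, HasContactOrder pAt l₁ l₂ k ↔ k = K)) := by
  obtain ⟨x₁, rfl⟩ : ∃ x₁ : ℝ, τ₁ = beta x₁ :=
    ⟨(betaInv τ₁).re, by rw [← betaInv_eq_ofReal hτ₁, beta_betaInv hτ₁']⟩
  obtain ⟨x₂, rfl⟩ : ∃ x₂ : ℝ, τ₂ = beta x₂ :=
    ⟨(betaInv τ₂).re, by rw [← betaInv_eq_ofReal hτ₂, beta_betaInv hτ₂']⟩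
  have hl₂' : l₂ = beta (((x₂ - t * x₁) / (1 - t) : ℝ) : ℂ) := by
    rw [hl₂, betaInv_beta_ofReal, betaInv_beta_ofReal]
    push_cast
    rfl
  subst hl₁ hl₂'
  set e := (cornerMatrix G).det
  set h := (cornerMatrix G).adjugate (Fin.last n) (Fin.last n)
  -- The uncolored-parameter case t = 0 is the trivial shift, so both denominators come from the
  -- same e and h.
  obtain ⟨r₀, m₀, H₀⟩ := exists_isPencilFraction_phiA G le_rfl zero_lt_one hA
  have hs₀ : shiftLeft 0 e h = e := by simp [shiftLeft]
  have hs₀' : shiftRight 0 h = h := by simp [shiftRight]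
  rw [hs₀, hs₀'] at H₀
  obtain ⟨r, m, H⟩ := exists_isPencilFraction_phiA G ht₀ ht₁ hAt
  refine ⟨?_, fun hp => ?_⟩
  · rw [H₀.eval_den_eq_zero_iff_hasRealLimit, H.eval_den_eq_zero_iff_hasRealLimit,
      hasRealLimit_shift_iff ht₁]
  · have hC := H₀.hasRealLimit_of_eval_den_eq_zero hp
    have hC' := (hasRealLimit_shift_iff ht₁ e h x₁ x₂).2 hC
    obtain ⟨K, hK⟩ := hC.exists_im_isTheta
    refine ⟨K, fun k => ?_, fun k => ?_⟩
    · rw [H₀.hasContactOrder_iff hC, isTheta_abs_sub_pow_iff hK]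
    · have hK' : (fun x => (realQuot (shiftLeft t e h) (shiftRight t h) x).im) =Θ[𝓝[≠] x₁]
          fun x => |x - x₁| ^ K := by
        simp_rw [realQuot_shift_im ht₁, div_eq_inv_mul]
        exact (isTheta_const_mul_left (inv_ne_zero (sub_pos.2 ht₁).ne')).2 hK
      rw [H.hasContactOrder_iff hC', isTheta_abs_sub_pow_iff hK']
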